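/- Let $n\ge 2$, let $\langle x,y\rangle=x_1y_1+\dots+x_ny_n-x_{n+1}y_{n+1}$ be the Lorentz form on $\mathbb{R}^{n+1}$, and let $\mathbb{H}^n=\{x\in\mathbb{R}^{n+1}:\langle x,x\rangle=-1,\ x_{n+1}>0\}$ be hyperbolic space with the Riemannian metric induced by $\langle\cdot,\cdot\rangle$; write $\nabla$ and $\operatorname{div}_{\mathbb{H}^n}$ for its gradient and divergence. Let $\Omega\subset\mathbb{H}^n$ be a bounded domain, let $\mathcal{C}_{A}=\{\rho q: q\in A,\ \rho>0\}$ denote the cone spanned by a set $A\subset\mathbb H^n$, and let $H\in C^1(\mathcal{C}_{\overline\Omega})$. Here $C^k$ up to the closure means: $C^k$ on the open set ($\Omega$, respectively $\mathcal C_\Omega$), continuous on $\overline\Omega$ (respectively $\mathcal C_{\overline\Omega}$), with all derivatives of order at most $k$ extending continuously to $\overline\Omega$ (respectively $\mathcal C_{\overline\Omega}$). Let $r_1,r_2\in\mathbb{R}$ satisfy $0<r_1\le 1\le r_2$ and $r_1\ne r_2$, and let $\nu_0>0$. Then there is a constant $C>0$, depending only on $n,r_1,r_2,\nu_0,\Omega,H$,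 such that for every $t\in[0,1]$ and every $u\in C^3(\overline\Omega)$ that solves $$\begin{cases}-\operatorname{div}_{\mathbb{H}^n}\!\left(\dfrac{\nabla u}{\sqrt{1-|\nabla u|^2}}\right)+\dfrac{nt}{\sqrt{1-|\nabla u|^2}}=nt\,e^{u}H(e^{u}q)&\text{for } q\in\Omega,\\ |\nabla u|<1&\text{in }\Omega,\\ u=0&\text{on }\partial\Omega,\end{cases}$$ and satisfies $\log r_1\le u\le\log r_2$ in $\Omega$ and $\sup_{\partial\Omega}\nu\le\nu_0$, where $\nu=(1-|\nabla u|^2)^{-1/2}$ (with $\nu=+\infty$ where $|\nabla u|=1$, so that in particular $|\nabla u|<1$ on $\partial\Omega$; on $\partial\Omega$, $\nabla u$ is the continuous extension of the gradient from $\Omega$), one has $$\sup_{\Omega}\nu\le C.$$ -/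

import Mathlib

namespace HBump

noncomputable section

/-- The vector space underlying the Lorentz–Minkowski space `𝕃^{n+1}`. -/
abbrev L (n : ℕ) : Type := EuclideanSpace ℝ (Fin (n + 1))

variable {n : ℕ}

/-- The Lorentz form `⟨x, y⟩ = x₁ y₁ + ⋯ + xₙ yₙ - xₙ₊₁ yₙ₊₁`. -/
def lor (x y : L n) : ℝ :=
  (∑ i : Fin n, x i.castSucc * y i.castSucc) - x (Fin.last n) * y (Fin.last n)

/-- The modulus `|v| = √|⟨v, v⟩|`. -/
def lmod (v : L n) : ℝ := Real.sqrt |lor v v|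

/-- Hyperbolic space `ℍⁿ`, as the upper sheet of the hyperboloid. -/
def hyp (n : ℕ) : Set (L n) := {x | lor x x = -1 ∧ 0 < x (Fin.last n)}

/-- The Riemannian distance of `ℍⁿ`: `cosh d(p, q) = -⟨p, q⟩`. -/
def hdist (p q : L n) : ℝ := Real.arcosh (-lor p q)

/-- A bounded domain of `ℍⁿ`: a nonempty connected (relatively) open subset of `ℍⁿ` that is
bounded for the hyperbolic distance. -/
structure IsBoundedDomain (Ω : Set (L n)) : Prop where
  isOpen : ∃ U : Set (L n), IsOpen U ∧ Ω = hyp n ∩ U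
  isConnected : IsConnected Ω
  bounded : ∃ R : ℝ, ∀ p ∈ Ω, ∀ q ∈ Ω, hdist p q ≤ R

/-- The boundary in `ℍⁿ` of a relatively open subset of `ℍⁿ`. Since `ℍⁿ` is closed in `𝕃^{n+1}`,
the closure in `ℍⁿ` is the closure in `𝕃^{n+1}`. -/
def bdry (Ω : Set (L n)) : Set (L n) := closure Ω \ Ω

/-- The cone `{ρ q : q ∈ A, ρ > 0}` spanned by `A`. -/
def cone (A : Set (L n)) : Set (L n) := {x | ∃ q ∈ A, ∃ ρ : ℝ, 0 < ρ ∧ x = ρ • q}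

/-- The extension, constant along rays, of a map defined on (a part of) `ℍⁿ` to the cone over it. -/
def radialExt {F : Type*} (f : L n → F) (x : L n) : F := f ((lmod x)⁻¹ • x)

/-- `f ∈ C^k` up to the boundary, for an open set `U` and a set `K` between `U` and its closure:
`f` is `C^k` on `U` and continuous on `K`, and every derivative of order at most `k` has a
continuous extension from `U` to `K`. -/
def ContDiffUpTo (k : ℕ) (f : L n → ℝ) (U K : Set (L n)) : Prop :=
  ContDiffOn ℝ k f U ∧ ContinuousOn f K ∧
    ∀ j : ℕ, j ≤ k → ∃ g : L n → ContinuousMultilinearMap ℝ (fun _ : Fin j => L n) ℝ,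
      ContinuousOn g K ∧ Set.EqOn (iteratedFDeriv ℝ j f) g U

/-- `u ∈ C^k(Ω̄)` for `Ω` open in `ℍⁿ`. Only the values of `u` on `Ω̄` matter. -/
def MemCkClosure (k : ℕ) (u : L n → ℝ) (Ω : Set (L n)) : Prop :=
  ContDiffUpTo k (radialExt u) (cone Ω) (cone (closure Ω))

/-- The vector `v` with `⟨v, X⟩ = φ X` for all `X ∈ 𝕃^{n+1}`. -/
def sharp (φ : L n →L[ℝ] ℝ) : L n :=
  WithLp.toLp 2 fun i =>
    if i = Fin.last n then -φ (EuclideanSpace.single i 1) else φ (EuclideanSpace.single i 1)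

/-- The gradient `∇u` on `ℍⁿ`: the tangent vector at `q` with `⟨∇u, X⟩ = du(X)` for `X` in
`T_q ℍⁿ = {X : ⟨X, q⟩ = 0}`. (It is tangent because the radial extension has derivative zero
in the direction `q`.) -/
def hgrad (u : L n → ℝ) (q : L n) : L n := sharp (fderiv ℝ (radialExt u) q)

/-- The Lorentz-orthogonal projection of `w` to `T_q ℍⁿ`, for `q ∈ ℍⁿ`. -/
def tangentProj (q w : L n) : L n := w + lor w q • q

/-- The Levi-Civita connection of `ℍⁿ`: `∇_X V` at `q` is the tangential part of the derivative of
the tangent field `V` in the direction `X ∈ T_q ℍⁿ`. (For `X = q` it is zero.) -/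
def covDeriv (V : L n → L n) (q X : L n) : L n :=
  tangentProj q (fderiv ℝ (radialExt V) q X)

/-- The divergence on `ℍⁿ` of a tangent field: the trace of `X ↦ ∇_X V`. The trace is taken over
`𝕃^{n+1} = T_q ℍⁿ ⊕ ℝ q`, where the summand `ℝ q` contributes zero. -/
def hdiv (V : L n → L n) (q : L n) : ℝ :=
  ∑ i : Fin (n + 1), covDeriv V q (EuclideanSpace.single i 1) i

/-- `ν = 1 / √(1 - |v|²)` as a function of the gradient `v`; used only where `|v| < 1`. -/
def nu (v : L n) : ℝ := 1 / Real.sqrt (1 - lmod v ^ 2)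

/-- The gradient of `u ∈ C¹(Ω̄)` at points of the closure of `Ω`, where it is the limit of the
gradient from inside `Ω`. -/
def hgradBar (u : L n → ℝ) (Ω : Set (L n)) : L n → L n := extendFrom Ω (hgrad u)

/-- `u` solves
`-div (∇u / √(1 - |∇u|²)) + n t / √(1 - |∇u|²) = n t e^u H(e^u q)` in `Ω`, `|∇u| < 1` in `Ω`,
`u = 0` on `∂Ω`. -/
structure IsSolution (Ω : Set (L n)) (H : L n → ℝ) (t : ℝ) (u : L n → ℝ) : Prop where
  eqn : ∀ q ∈ Ω,
    -hdiv (fun p => nu (hgrad u p) • hgrad u p) q + n * t * nu (hgrad u q) =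
      n * t * Real.exp (u q) * H (Real.exp (u q) • q)
  spacelike : ∀ q ∈ Ω, lmod (hgrad u q) < 1
  boundary : ∀ q ∈ bdry Ω, u q = 0

end

end HBump

/-!
Bernstein's method: the function `log ν + (n / 2) u²` is compared at its maximum. On the boundary
`ν ≤ ν₀` is given. At an interior maximum one applies the elliptic operator `Δ + ν² ∇²(∇u, ∇u)`,
the linearization of the mean curvature operator up to first order terms, and eliminates the third
derivatives of `u` by differentiating the equation along `∇u`. The Ricci curvature `-(n - 1)` of
`ℍⁿ` contributes a term of the wrong sign, which is dominated by the contribution of `(n / 2) u²`;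
what remains bounds `ν` by the data. Every function on `ℍⁿ` is extended homogeneously to the cone,
so that covariant derivatives become flat derivatives in `ℝⁿ⁺¹`.
-/

namespace HBump

noncomputable section

open Filter Topology

variable {n : ℕ}

/-- The Lorentz form as a continuous bilinear map. -/
def lorL : L n →L[ℝ] L n →L[ℝ] ℝ :=
  (LinearMap.mk₂ ℝ (lor (n := n))
    (fun x y z => by simp only [lor, PiLp.add_apply, add_mul, Finset.sum_add_distrib]; ring)
    (fun c x y => by
      simp only [lor, PiLp.smul_apply, smul_eq_mul, mul_sub, Finset.mul_sum, mul_assoc])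
    (fun x y z => by simp only [lor, PiLp.add_apply, mul_add, Finset.sum_add_distrib]; ring)
    (fun c x y => by
      simp only [lor, PiLp.smul_apply, smul_eq_mul, mul_sub, Finset.mul_sum,
        mul_left_comm])).toContinuousBilinearMap

lemma lorL_apply (x y : L n) : lorL x y = lor x y := rfl

lemma lor_comm (x y : L n) : lor x y = lor y x := by
  simp only [lor, mul_comm]

lemma lor_add_left (x y z : L n) : lor (x + y) z = lor x z + lor y z := by
  simp only [← lorL_apply, map_add, add_apply]

lemma lor_add_right (x y z : L n) : lor x (y + z) = lor x y + lor x z := by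
  simp only [← lorL_apply, map_add]

lemma lor_smul_left (c : ℝ) (x y : L n) : lor (c • x) y = c * lor x y := by
  simp only [← lorL_apply, map_smul, smul_apply, smul_eq_mul]

lemma lor_smul_right (c : ℝ) (x y : L n) : lor x (c • y) = c * lor x y := by
  simp only [← lorL_apply, map_smul, smul_eq_mul]

lemma lor_neg_left (x y : L n) : lor (-x) y = -lor x y := by
  simp only [← lorL_apply, map_neg, neg_apply]

lemma lor_neg_right (x y : L n) : lor x (-y) = -lor x y := by
  simp only [← lorL_apply, map_neg]

lemma lor_zero_right (x : L n) : lor x 0 = 0 := by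
  simp only [← lorL_apply, map_zero]

lemma lor_single_castSucc (x : L n) (i : Fin n) :
    lor x (EuclideanSpace.single i.castSucc 1) = x i.castSucc := by
  simp [lor, (Fin.castSucc_ne_last _).symm]

lemma lor_single_last (x : L n) :
    lor x (EuclideanSpace.single (Fin.last n) 1) = -x (Fin.last n) := by
  simp [lor, Fin.castSucc_ne_last]

lemma ext_lor_left {x y : L n} (h : ∀ z, lor x z = lor y z) : x = y := by
  ext i
  rcases Fin.eq_castSucc_or_eq_last i with ⟨j, rfl⟩ | rfl
  · simpa only [lor_single_castSucc] using h (EuclideanSpace.single j.castSucc 1)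
  · simpa only [lor_single_last, neg_inj] using h (EuclideanSpace.single (Fin.last n) 1)

lemma sum_smul_single (x : L n) :
    ∑ i : Fin (n + 1), x i • (EuclideanSpace.single i 1 : L n) = x := by
  simpa only [EuclideanSpace.basisFun_apply, EuclideanSpace.basisFun_repr] using
    (EuclideanSpace.basisFun (Fin (n + 1)) ℝ).sum_repr x

lemma continuous_lor_self : Continuous fun x : L n => lor x x :=
  (lorL (n := n)).continuous₂.comp (continuous_id.prodMk continuous_id)

lemma hasDerivAt_lor {f g : ℝ → L n} {f' g' : L n} {s : ℝ} (hf : HasDerivAt f f' s)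
    (hg : HasDerivAt g g' s) :
    HasDerivAt (fun s => lor (f s) (g s)) (lor f' (g s) + lor (f s) g') s :=
  ((lorL (n := n)).hasFDerivAt.comp_hasDerivAt s hf).clm_apply hg

lemma hasFDerivAt_lor {E : Type*} [NormedAddCommGroup E] [NormedSpace ℝ E] {f g : E → L n}
    {f' g' : E →L[ℝ] L n} {x : E} (hf : HasFDerivAt f f' x) (hg : HasFDerivAt g g' x) :
    HasFDerivAt (fun y => lor (f y) (g y)) ((lorL (f x)).comp g' + (lorL.flip (g x)).comp f') x :=
  ((lorL (n := n)).hasFDerivAt.comp x hf).clm_apply hg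

/-- The trace of an endomorphism of `𝕃^{n+1}`, as a continuous linear form. -/
def tr : (L n →L[ℝ] L n) →L[ℝ] ℝ :=
  ((LinearMap.trace ℝ (L n)).comp (ContinuousLinearMap.coeLM ℝ)).toContinuousLinearMap

lemma tr_eq_trace (M : L n →L[ℝ] L n) : tr M = LinearMap.trace ℝ (L n) M := rfl

lemma tr_apply (M : L n →L[ℝ] L n) :
    tr M = ∑ i : Fin (n + 1), M (EuclideanSpace.single i 1) i := by
  rw [tr_eq_trace, LinearMap.trace_eq_sum_inner _ (EuclideanSpace.basisFun (Fin (n + 1)) ℝ)]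
  simp [EuclideanSpace.inner_single_left]

lemma tr_smulRight (φ : L n →L[ℝ] ℝ) (v : L n) : tr (φ.smulRight v) = φ v :=
  LinearMap.trace_smulRight (φ : L n →ₗ[ℝ] ℝ) v

lemma sum_sq_castSucc {q : L n} (hq : q ∈ hyp n) :
    ∑ i : Fin n, q i.castSucc ^ 2 = q (Fin.last n) ^ 2 - 1 := by
  have := hq.1
  simp only [lor, ← sq] at this
  linarith

lemma lor_tangentProj {q : L n} (hq : q ∈ hyp n) (X : L n) : lor (tangentProj q X) q = 0 := by
  rw [tangentProj, lor_add_left, lor_smul_left, hq.1]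
  ring

section Frame

/-- The Lorentz-orthonormal frame of `T_q ℍⁿ` obtained by boosting the standard basis. -/
def frame (q : L n) (i : Fin n) : L n :=
  EuclideanSpace.single i.castSucc 1 +
    (q i.castSucc / (1 + q (Fin.last n))) • (q + EuclideanSpace.single (Fin.last n) 1)

lemma sum_bilin_add_smul {ι E : Type*} [Fintype ι] [AddCommGroup E] [Module ℝ E]
    (B : E →ₗ[ℝ] E →ₗ[ℝ] ℝ) (e : ι → E) (c : ι → ℝ) (v : E) :
    ∑ i, B (e i + c i • v) (e i + c i • v) =
      ∑ i, B (e i) (e i) + B (∑ i, c i • e i) v + B v (∑ i, c i • e i) +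
        (∑ i, c i ^ 2) * B v v := by
  simp only [map_sum, LinearMap.sum_apply, map_add, map_smul, LinearMap.add_apply,
    LinearMap.smul_apply, smul_eq_mul, Finset.sum_mul, ← Finset.sum_add_distrib]
  exact Finset.sum_congr rfl fun i _ => by ring

variable {q : L n}

lemma lor_frame_base (hq : q ∈ hyp n) (i : Fin n) : lor (frame q i) q = 0 := by
  have h1 : 1 + q (Fin.last n) ≠ 0 := by have := hq.2; positivity
  rw [frame, lor_add_left, lor_smul_left, lor_add_left, hq.1, lor_comm _ q, lor_comm _ q,
    lor_single_castSucc, lor_single_last]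
  field_simp
  ring

lemma sum_frame (hq : q ∈ hyp n) (B : L n →ₗ[ℝ] L n →ₗ[ℝ] ℝ) :
    ∑ i, B (frame q i) (frame q i) =
      (∑ i : Fin n, B (EuclideanSpace.single i.castSucc 1) (EuclideanSpace.single i.castSucc 1)) -
        B (EuclideanSpace.single (Fin.last n) 1) (EuclideanSpace.single (Fin.last n) 1) +
        B q q := by
  set τ := q (Fin.last n) with hτ
  set e : L n := EuclideanSpace.single (Fin.last n) 1
  have hτ1 : 1 + τ ≠ 0 := by have := hq.2; positivity
  have hspace : ∑ i : Fin n, (q i.castSucc / (1 + τ)) • (EuclideanSpace.single i.castSucc 1 : L n) =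
      (1 + τ)⁻¹ • (q - τ • e) := by
    have h := sum_smul_single q
    rw [Fin.sum_univ_castSucc] at h
    rw [← eq_sub_of_add_eq h, Finset.smul_sum]
    exact Finset.sum_congr rfl fun i _ => by rw [smul_smul, div_eq_inv_mul]
  have hcoeff : ∑ i : Fin n, (q i.castSucc / (1 + τ)) ^ 2 = (τ ^ 2 - 1) / (1 + τ) ^ 2 := by
    simp only [div_pow, ← Finset.sum_div, sum_sq_castSucc hq, hτ]
  simp only [frame]
  rw [sum_bilin_add_smul, hspace, hcoeff]
  simp only [map_add, map_sub, map_smul, LinearMap.add_apply, LinearMap.sub_apply,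
    LinearMap.smul_apply, smul_eq_mul]
  field_simp
  ring

lemma sum_lor_map_frame (hq : q ∈ hyp n) (M : L n →L[ℝ] L n) :
    ∑ i, lor (M (frame q i)) (frame q i) = tr M + lor (M q) q := by
  have h := sum_frame hq ((lorL (n := n)).toLinearMap₁₂.comp M.toLinearMap)
  simp only [LinearMap.comp_apply, ContinuousLinearMap.toLinearMap₁₂_apply_apply_apply,
    ContinuousLinearMap.coe_coe, lorL_apply, lor_single_castSucc, lor_single_last] at h
  rw [h, tr_apply, Fin.sum_univ_castSucc]
  ring

lemma sum_lor_frame_mul (hq : q ∈ hyp n) (X Y : L n) :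
    ∑ i, lor X (frame q i) * lor Y (frame q i) = lor X Y + lor X q * lor Y q := by
  have h := sum_frame hq ((LinearMap.mul ℝ ℝ).compl₁₂ (lorL X).toLinearMap (lorL Y).toLinearMap)
  simp only [LinearMap.compl₁₂_apply, LinearMap.mul_apply',
    ContinuousLinearMap.coe_coe, lorL_apply, lor_single_castSucc, lor_single_last] at h
  rw [h]
  simp only [lor]
  ring

lemma sum_lor_frame_self (hq : q ∈ hyp n) : ∑ i, lor (frame q i) (frame q i) = n := by
  have h := sum_lor_map_frame hq (ContinuousLinearMap.id ℝ (L n))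
  simp only [ContinuousLinearMap.id_apply, tr_eq_trace, ContinuousLinearMap.coe_id,
    LinearMap.trace_id, finrank_euclideanSpace, Fintype.card_fin, hq.1] at h
  rw [h]
  push_cast
  ring

lemma neg_sq_lor_le_lor_self (hq : q ∈ hyp n) (X : L n) : -(lor X q) ^ 2 ≤ lor X X := by
  have hsum := sum_lor_frame_mul hq X X
  have hnonneg : 0 ≤ ∑ i, lor X (frame q i) * lor X (frame q i) :=
    Finset.sum_nonneg fun i _ => mul_self_nonneg _
  linarith [sq (lor X q)]

lemma lor_self_nonneg_of_tangent (hq : q ∈ hyp n) {X : L n} (hX : lor X q = 0) : 0 ≤ lor X X := by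
  simpa [hX] using neg_sq_lor_le_lor_self hq X

end Frame

/-- The identities satisfied at `q ∈ ℍⁿ` by the gradient `p = ∇u` of a function and by the first two
flat derivatives `A` and `T` of its extension homogeneous of degree `-1` to the cone, which are
homogeneous of degrees `-2` and `-3`. -/
structure IsGradientJet (q p : L n) (A : L n →L[ℝ] L n) (T : L n →L[ℝ] L n →L[ℝ] L n) : Prop where
  lor_base : lor p q = 0
  symm : ∀ X Y, lor (A X) Y = lor X (A Y)
  apply_base : A q = -p
  symm₂ : ∀ X Y, T X Y = T Y X
  symm₃ : ∀ X Y Z, lor (T X Y) Z = lor (T X Z) Y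
  apply_base₂ : ∀ X, T X q = -(2 : ℝ) • A X

/-- The second derivative at `q ∈ ℍⁿ` of `log ν + F(u)` in the tangent direction `X`, where
`N = ν`, `f₁ = F'(u)`, `f₂ = F''(u)` and `(p, A, T)` is the gradient jet of `u`. -/
def hessForm (p : L n) (A : L n →L[ℝ] L n) (T : L n →L[ℝ] L n →L[ℝ] L n) (N f₁ f₂ : ℝ)
    (X : L n) : ℝ :=
  N ^ 2 * (-lor X X * lor p p + lor (A X) (A X) + lor (T X X) p) +
    2 * N ^ 4 * lor (A X) p ^ 2 + f₁ * lor (A X) X + f₂ * lor p X ^ 2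

namespace IsGradientJet

variable {q p : L n} {A : L n →L[ℝ] L n} {T : L n →L[ℝ] L n →L[ℝ] L n} {N f₁ f₂ l : ℝ}

lemma lor_map_base (J : IsGradientJet q p A T) (X : L n) : lor (A X) q = -lor X p := by
  rw [J.symm, J.apply_base, lor_neg_right]

lemma map_gradient_of_forall_tangent (J : IsGradientJet q p A T) (hq : q ∈ hyp n)
    (h : ∀ X, lor X q = 0 → lor (A X) p = l * lor p X) : A p = l • p + lor p p • q := by
  refine ext_lor_left fun z => ?_
  have hz := h _ (lor_tangentProj hq z)
  rw [J.symm, lor_comm _ (A p)] at hz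
  simp only [tangentProj, lor_add_right, lor_smul_right, J.lor_base, J.lor_map_base,
    lor_add_left, lor_smul_left] at hz ⊢
  rw [lor_comm q z]
  linear_combination hz

lemma sum_lor_map₂_frame (J : IsGradientJet q p A T) (hq : q ∈ hyp n) :
    ∑ i, lor (T (frame q i) (frame q i)) p = tr (T p) + 2 * lor p p := by
  have h := sum_lor_map_frame hq (T p)
  rw [J.apply_base₂, lor_smul_left, J.lor_map_base] at h
  simp only [J.symm₃ _ _ p, J.symm₂ _ p, h]
  ring

lemma sum_lor_map_frame_eq_tr (J : IsGradientJet q p A T) (hq : q ∈ hyp n) :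
    ∑ i, lor (A (frame q i)) (frame q i) = tr A := by
  rw [sum_lor_map_frame hq, J.apply_base, lor_neg_left, J.lor_base, neg_zero, add_zero]

lemma sum_sq_lor_frame (J : IsGradientJet q p A T) (hq : q ∈ hyp n) :
    ∑ i, lor p (frame q i) ^ 2 = lor p p := by
  simp only [sq, sum_lor_frame_mul hq, J.lor_base, mul_zero, add_zero]

lemma neg_lor_self_le_sum (J : IsGradientJet q p A T) (hq : q ∈ hyp n) :
    -lor p p ≤ ∑ i, lor (A (frame q i)) (A (frame q i)) := by
  rw [← J.sum_sq_lor_frame hq, ← Finset.sum_neg_distrib]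
  refine Finset.sum_le_sum fun i _ => ?_
  simpa only [J.lor_map_base, neg_sq, lor_comm _ p] using neg_sq_lor_le_lor_self hq (A (frame q i))

lemma le_sum_hessForm_frame (J : IsGradientJet q p A T) (hq : q ∈ hyp n)
    (h : ∀ X, lor X q = 0 → lor (A X) p = l * lor p X) :
    N ^ 2 * (tr (T p) - (n - 1) * lor p p) + 2 * N ^ 4 * l ^ 2 * lor p p + f₁ * tr A +
      f₂ * lor p p ≤ ∑ i, hessForm p A T N f₁ f₂ (frame q i) := by
  have hframe := fun i => h _ (lor_frame_base hq i)
  have hsum := mul_le_mul_of_nonneg_left (J.neg_lor_self_le_sum hq) (sq_nonneg N)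
  simp only [hessForm, hframe, mul_pow, Finset.sum_add_distrib, ← Finset.mul_sum, neg_mul,
    Finset.sum_neg_distrib, ← Finset.sum_mul, sum_lor_frame_self hq, J.sum_lor_map₂_frame hq,
    J.sum_lor_map_frame_eq_tr hq, J.sum_sq_lor_frame hq]
  linear_combination hsum

lemma lor_map_gradient_self (J : IsGradientJet q p A T) (hq : q ∈ hyp n)
    (hA : A p = l • p + lor p p • q) :
    lor (A p) (A p) = l ^ 2 * lor p p - lor p p ^ 2 := by
  rw [hA]
  simp only [lor_add_left, lor_add_right, lor_smul_left, lor_smul_right, lor_comm q p, J.lor_base,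
    hq.1]
  ring

/-- With `N = ν` and `κ = tr A + N² ⟨A p, p⟩`, the coefficient of `N²` is the derivative of `κ` in
the direction `p`: this is what the differentiated equation controls. The inequality is the sum
of `hessForm` over an orthonormal frame plus `N²` times its value at `p`. -/
lemma bernstein (J : IsGradientJet q p A T) (hq : q ∈ hyp n) (hN : N ^ 2 * (1 - lor p p) = 1)
    (first : ∀ X, lor X q = 0 → N ^ 2 * lor (A X) p + f₁ * lor p X = 0)
    (second : ∀ X, lor X q = 0 → hessForm p A T N f₁ f₂ X ≤ 0) :
    N ^ 2 * (tr (T p) + N ^ 2 * (lor (T p p) p + 2 * lor (A p) (A p)) +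
        2 * N ^ 4 * lor (A p) p ^ 2) +
      f₁ * (tr A + N ^ 2 * lor (A p) p) + (f₂ - (n - 1)) * (N ^ 2 - 1) ≤ 0 := by
  have hN0 : N ≠ 0 := by rintro rfl; norm_num at hN
  obtain ⟨l, hl⟩ : ∃ l, N ^ 2 * l = -f₁ := ⟨-f₁ / N ^ 2, by field_simp⟩
  have hcrit : ∀ X, lor X q = 0 → lor (A X) p = l * lor p X := fun X hX =>
    mul_left_cancel₀ (pow_ne_zero 2 hN0) (by linear_combination first X hX - lor p X * hl)
  have hAA := J.lor_map_gradient_self hq (J.map_gradient_of_forall_tangent hq hcrit)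
  have hframe := (J.le_sum_hessForm_frame hq hcrit (N := N) (f₁ := f₁) (f₂ := f₂)).trans
    (Finset.sum_nonpos fun i _ => second _ (lor_frame_base hq i))
  have hself := mul_nonpos_of_nonneg_of_nonpos (sq_nonneg N) (second p J.lor_base)
  have hw : 0 ≤ lor p p := lor_self_nonneg_of_tangent hq J.lor_base
  have hsq : 0 ≤ N ^ 4 * l ^ 2 * lor p p := by positivity
  have hN4 : N ^ 2 * lor p p = N ^ 2 - 1 := by linear_combination -hN
  rw [hessForm, hcrit p J.lor_base, hAA] at hself
  rw [hcrit p J.lor_base, hAA]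
  generalize lor p p = w at *
  linear_combination hframe + hself + hsq - (f₂ * w + f₂ - (n - 1)) * hN4

end IsGradientJet

section Cone

lemma lmod_smul {c : ℝ} (hc : 0 < c) (x : L n) : lmod (c • x) = c * lmod x := by
  rw [lmod, lmod, lor_smul_left, lor_smul_right, ← mul_assoc, abs_mul, Real.sqrt_mul (abs_nonneg _),
    abs_mul_self, Real.sqrt_mul_self hc.le]

lemma lmod_of_mem_hyp {q : L n} (hq : q ∈ hyp n) : lmod q = 1 := by
  rw [lmod, hq.1, abs_neg, abs_one, Real.sqrt_one]

lemma continuous_lmod : Continuous (lmod (n := n)) :=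
  Real.continuous_sqrt.comp (continuous_abs.comp continuous_lor_self)

lemma lmod_pos {x : L n} (hx : lor x x < 0) : 0 < lmod x :=
  Real.sqrt_pos.2 (abs_pos.2 hx.ne)

lemma lmod_sq_of_neg {x : L n} (hx : lor x x < 0) : lmod x ^ 2 = -lor x x := by
  rw [lmod, Real.sq_sqrt (abs_nonneg _), abs_of_neg hx]

lemma radialExt_of_mem_hyp {F : Type*} (f : L n → F) {q : L n} (hq : q ∈ hyp n) :
    radialExt f q = f q := by
  rw [radialExt, lmod_of_mem_hyp hq, inv_one, one_smul]

lemma subset_cone (A : Set (L n)) : A ⊆ cone A := fun q hq => ⟨q, hq, 1, one_pos, by simp⟩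

lemma inv_lmod_smul_mem_hyp {x : L n} (hx : lor x x < 0) (hx' : 0 < x (Fin.last n)) :
    (lmod x)⁻¹ • x ∈ hyp n := by
  have h := lmod_pos hx
  refine ⟨?_, mul_pos (inv_pos.2 h) hx'⟩
  rw [lor_smul_left, lor_smul_right, ← neg_eq_iff_eq_neg.2 (lmod_sq_of_neg hx)]
  field_simp

lemma inv_lmod_smul_mem {A : Set (L n)} (hA : A ⊆ hyp n) {x : L n} (hx : x ∈ cone A) :
    (lmod x)⁻¹ • x ∈ A := by
  obtain ⟨q, hq, ρ, hρ, rfl⟩ := hx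
  rwa [lmod_smul hρ, lmod_of_mem_hyp (hA hq), mul_one, smul_smul, inv_mul_cancel₀ hρ.ne', one_smul]

lemma cone_hyp_inter (U : Set (L n)) :
    cone (hyp n ∩ U) = {x : L n | lor x x < 0 ∧ 0 < x (Fin.last n)} ∩
      (fun x => (lmod x)⁻¹ • x) ⁻¹' U := by
  ext x
  constructor
  · intro hx
    refine ⟨?_, (inv_lmod_smul_mem Set.inter_subset_left hx).2⟩
    obtain ⟨q, ⟨hq, -⟩, ρ, hρ, rfl⟩ := hx
    refine ⟨?_, mul_pos hρ hq.2⟩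
    rw [lor_smul_left, lor_smul_right, hq.1]
    nlinarith
  · rintro ⟨⟨hx, hx'⟩, hxU⟩
    refine ⟨_, ⟨inv_lmod_smul_mem_hyp hx hx', hxU⟩, lmod x, lmod_pos hx, ?_⟩
    rw [smul_smul, mul_inv_cancel₀ (lmod_pos hx).ne', one_smul]

lemma isOpen_cone {Ω : Set (L n)} (hΩ : ∃ U : Set (L n), IsOpen U ∧ Ω = hyp n ∩ U) :
    IsOpen (cone Ω) := by
  obtain ⟨U, hU, rfl⟩ := hΩ
  rw [cone_hyp_inter]
  refine ContinuousOn.isOpen_inter_preimage ?_ ?_ hU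
  · exact (continuous_lmod.continuousOn.inv₀ fun x hx => (lmod_pos hx.1).ne').smul continuousOn_id
  · exact (isOpen_lt continuous_lor_self continuous_const).inter
      (isOpen_lt continuous_const (EuclideanSpace.proj (𝕜 := ℝ) (Fin.last n)).continuous)

end Cone

section Homogeneous

variable {E F G : Type*} [NormedAddCommGroup E] [NormedSpace ℝ E] [NormedAddCommGroup F]
  [NormedSpace ℝ F] [NormedAddCommGroup G] [NormedSpace ℝ G] {k : ℤ} {f : E → F}

/-- Positive homogeneity of degree `k`. -/
def PosHomogeneous (k : ℤ) (f : E → F) : Prop :=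
  ∀ ⦃c : ℝ⦄, 0 < c → ∀ x, f (c • x) = c ^ k • f x

namespace PosHomogeneous

lemma clm_comp (hf : PosHomogeneous k f) (M : F →L[ℝ] G) : PosHomogeneous k fun x => M (f x) :=
  fun _ hc x => (congrArg M (hf hc x)).trans (M.map_smul _ _)

lemma fderiv (hf : PosHomogeneous k f) : PosHomogeneous (k - 1) (fderiv ℝ f) := by
  intro c hc x
  have h := fderiv_comp_smul (𝕜 := ℝ) (f := f) (x := x) c
  rw [funext (hf hc), ← Pi.smul_def, fderiv_const_smul_field, Pi.smul_apply] at h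
  rw [zpow_sub_one₀ hc.ne', mul_comm, mul_smul, h, inv_smul_smul₀ hc.ne']

lemma fderiv_self (hf : PosHomogeneous k f) {x : E} (hx : DifferentiableAt ℝ f x) :
    _root_.fderiv ℝ f x x = (k : ℝ) • f x := by
  have hray : HasDerivAt (fun c : ℝ => c • x) x 1 := by
    simpa only [one_smul] using (hasDerivAt_id' (1 : ℝ)).smul_const x
  have hcomp := HasFDerivAt.comp_hasDerivAt (f := fun c : ℝ => c • x) (1 : ℝ)
    (by simpa only [one_smul] using hx.hasFDerivAt) hray
  have hpow : HasDerivAt (fun c : ℝ => c ^ k • f x) ((k : ℝ) • f x) 1 := by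
    simpa only [one_zpow, mul_one] using
      (hasDerivAt_zpow k (1 : ℝ) (.inl one_ne_zero)).smul_const (f x)
  exact hcomp.unique
    (hpow.congr_of_eventuallyEq ((eventually_gt_nhds one_pos).mono fun c hc => hf hc x))

end PosHomogeneous

end Homogeneous

lemma posHomogeneous_radialExt {F : Type*} [NormedAddCommGroup F] [NormedSpace ℝ F]
    (f : L n → F) : PosHomogeneous 0 (radialExt f) := by
  intro c hc x
  rw [zpow_zero, one_smul, radialExt, radialExt, lmod_smul hc, smul_smul, mul_inv, mul_right_comm,
    inv_mul_cancel₀ hc.ne', one_mul]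

section Gradient

lemma lor_sharp (φ : L n →L[ℝ] ℝ) (X : L n) : lor (sharp φ) X = φ X := by
  conv_rhs => rw [← sum_smul_single X, Fin.sum_univ_castSucc]
  simp only [lor, sharp, Fin.castSucc_ne_last, if_false, if_true, map_add, map_sum, map_smul,
    smul_eq_mul, mul_comm, sub_neg_eq_add, mul_neg]

/-- `sharp` as a continuous linear map. -/
def sharpL : (L n →L[ℝ] ℝ) →L[ℝ] L n :=
  LinearMap.toContinuousLinearMap
    { toFun := sharp
      map_add' := fun φ ψ => ext_lor_left fun z => by
        simp only [lor_add_left, lor_sharp, add_apply]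
      map_smul' := fun c φ => ext_lor_left fun z => by
        simp only [lor_smul_left, lor_sharp, smul_apply, smul_eq_mul, RingHom.id_apply] }

lemma sharpL_apply (φ : L n →L[ℝ] ℝ) : sharpL φ = sharp φ := rfl

variable {u : L n → ℝ} {x : L n}

lemma lor_hgrad (u : L n → ℝ) (x X : L n) : lor (hgrad u x) X = fderiv ℝ (radialExt u) x X :=
  lor_sharp _ _

lemma posHomogeneous_hgrad (u : L n → ℝ) : PosHomogeneous (-1) (hgrad u) :=
  (posHomogeneous_radialExt u).fderiv.clm_comp sharpL

lemma lor_hgrad_self (hu : DifferentiableAt ℝ (radialExt u) x) : lor (hgrad u x) x = 0 := by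
  rw [lor_hgrad, (posHomogeneous_radialExt u).fderiv_self hu, Int.cast_zero, zero_smul]

lemma contDiffAt_hgrad {m : ℕ} (hu : ContDiffAt ℝ (m + 1) (radialExt u) x) :
    ContDiffAt ℝ m (hgrad u) x :=
  sharpL.contDiff.contDiffAt.comp x (hu.fderiv_right le_rfl)

lemma lor_fderiv_hgrad (hu : ContDiffAt ℝ 2 (radialExt u) x) (X Y : L n) :
    lor (fderiv ℝ (hgrad u) x X) Y = fderiv ℝ (fderiv ℝ (radialExt u)) x X Y := by
  have hdiff : DifferentiableAt ℝ (fderiv ℝ (radialExt u)) x :=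
    (hu.fderiv_right (m := 1) le_rfl).differentiableAt one_ne_zero
  have h : fderiv ℝ (hgrad u) x = sharpL.comp (fderiv ℝ (fderiv ℝ (radialExt u)) x) :=
    (sharpL.hasFDerivAt.comp x hdiff.hasFDerivAt).fderiv
  rw [h, ContinuousLinearMap.comp_apply, sharpL_apply, lor_sharp]

lemma lor_fderiv_hgrad_comm (hu : ContDiffAt ℝ 2 (radialExt u) x) (X Y : L n) :
    lor (fderiv ℝ (hgrad u) x X) Y = lor (fderiv ℝ (hgrad u) x Y) X := by
  rw [lor_fderiv_hgrad hu, lor_fderiv_hgrad hu]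
  exact hu.isSymmSndFDerivAt (by simp) X Y

lemma lor_fderiv_fderiv_hgrad_comm (hu : ContDiffAt ℝ 3 (radialExt u) x) (X Y Z : L n) :
    lor (fderiv ℝ (fderiv ℝ (hgrad u)) x X Y) Z = lor (fderiv ℝ (fderiv ℝ (hgrad u)) x X Z) Y := by
  have hdiff : HasFDerivAt (fderiv ℝ (hgrad u)) (fderiv ℝ (fderiv ℝ (hgrad u)) x) x :=
    (((contDiffAt_hgrad (m := 2) hu).fderiv_right (m := 1) le_rfl).differentiableAt
      one_ne_zero).hasFDerivAt
  have hform (Y Z : L n) :=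
    (lorL.flip Z).hasFDerivAt.comp x (hdiff.clm_apply (hasFDerivAt_const Y x))
  have hsymm : ∀ᶠ y in 𝓝 x,
      lor (fderiv ℝ (hgrad u) y Y) Z = lor (fderiv ℝ (hgrad u) y Z) Y :=
    (hu.eventually (by simp)).mono fun y hy => lor_fderiv_hgrad_comm (hy.of_le (by norm_num)) Y Z
  simpa [lorL_apply] using
    DFunLike.congr_fun ((hform Y Z).unique ((hform Z Y).congr_of_eventuallyEq hsymm)) X

lemma isGradientJet_hgrad (hu : ContDiffAt ℝ 3 (radialExt u) x) :
    IsGradientJet x (hgrad u x) (fderiv ℝ (hgrad u) x) (fderiv ℝ (fderiv ℝ (hgrad u)) x) := by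
  have hu₂ : ContDiffAt ℝ 2 (radialExt u) x := hu.of_le (by norm_num)
  have hgrad₂ := contDiffAt_hgrad (m := 2) hu
  have hgrad₁ := hgrad₂.fderiv_right (m := 1) le_rfl
  have symm₂ := hgrad₂.isSymmSndFDerivAt (by simp)
  refine ⟨lor_hgrad_self (hu.differentiableAt (by simp)), fun X Y => ?_, ?_, symm₂,
    lor_fderiv_fderiv_hgrad_comm hu, fun X => ?_⟩
  · rw [lor_fderiv_hgrad_comm hu₂, lor_comm]
  · rw [(posHomogeneous_hgrad u).fderiv_self (hgrad₂.differentiableAt (by simp))]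
    norm_num
  · rw [← symm₂, (posHomogeneous_hgrad u).fderiv.fderiv_self (hgrad₁.differentiableAt one_ne_zero)]
    norm_num

end Gradient

section RadialProjection

/-- `tangentProj q` as a continuous linear map. -/
def tangentProjL (q : L n) : L n →L[ℝ] L n :=
  ContinuousLinearMap.id ℝ (L n) + (lorL.flip q).smulRight q

lemma tangentProjL_apply (q X : L n) : tangentProjL q X = tangentProj q X := rfl

lemma tangentProjL_self {q : L n} (hq : q ∈ hyp n) : tangentProjL q q = 0 := by
  rw [tangentProjL_apply, tangentProj, hq.1, neg_one_smul, add_neg_cancel]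

lemma tangentProjL_of_tangent {q X : L n} (hX : lor X q = 0) : tangentProjL q X = X := by
  rw [tangentProjL_apply, tangentProj, hX, zero_smul, add_zero]

lemma hasFDerivAt_lmod {q : L n} (hq : q ∈ hyp n) : HasFDerivAt lmod (-lorL q) q := by
  have hself := (hasFDerivAt_lor (hasFDerivAt_id q) (hasFDerivAt_id q)).abs_of_neg
    (by simp [hq.1])
  refine (hself.sqrt (by simp [hq.1])).congr_fderiv (ContinuousLinearMap.ext fun X => ?_)
  simp only [id_eq, hq.1, abs_neg, abs_one, Real.sqrt_one, mul_one, one_div,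
    ContinuousLinearMap.comp_id, neg_add_rev, smul_add, smul_neg, add_apply, neg_apply, smul_apply,
    ContinuousLinearMap.flip_apply, lorL_apply, lor_comm X q, smul_eq_mul]
  ring

lemma hasFDerivAt_inv_lmod_smul {q : L n} (hq : q ∈ hyp n) :
    HasFDerivAt (fun x : L n => (lmod x)⁻¹ • x) (tangentProjL q) q := by
  have hlmod : lmod q ≠ 0 := by simp [lmod_of_mem_hyp hq]
  refine (((hasDerivAt_inv hlmod).comp_hasFDerivAt q (hasFDerivAt_lmod hq)).smul
    (hasFDerivAt_id q)).congr_fderiv (ContinuousLinearMap.ext fun X => ?_)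
  simp [lmod_of_mem_hyp hq, tangentProjL, lorL_apply, lor_comm X q]

variable {Ω : Set (L n)} {F : Type*} [NormedAddCommGroup F] [NormedSpace ℝ F] {V W : L n → F}
  {V' W' : L n →L[ℝ] F} {q : L n}

lemma hasFDerivAt_radialExt (hΩ : Ω ⊆ hyp n) (hS : IsOpen (cone Ω)) (hq : q ∈ Ω)
    (hVW : Set.EqOn V W Ω) (hW : HasFDerivAt W W' q) :
    HasFDerivAt (radialExt V) (W'.comp (tangentProjL q)) q := by
  have hproj : (lmod q)⁻¹ • q = q := by rw [lmod_of_mem_hyp (hΩ hq), inv_one, one_smul]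
  refine (HasFDerivAt.comp (f := fun x : L n => (lmod x)⁻¹ • x) q (by rwa [hproj])
    (hasFDerivAt_inv_lmod_smul (hΩ hq))).congr_of_eventuallyEq ?_
  filter_upwards [hS.mem_nhds (subset_cone Ω hq)] with x hx
  exact hVW (inv_lmod_smul_mem hΩ hx)

lemma hasFDerivAt_apply_eq_of_eqOn (hΩ : Ω ⊆ hyp n) (hS : IsOpen (cone Ω)) (hq : q ∈ Ω)
    (hVW : Set.EqOn V W Ω) (hV : HasFDerivAt V V' q) (hW : HasFDerivAt W W' q) {X : L n}
    (hX : lor X q = 0) : V' X = W' X := by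
  have h := (hasFDerivAt_radialExt hΩ hS hq (Set.eqOn_refl V Ω) hV).unique
    (hasFDerivAt_radialExt hΩ hS hq hVW hW)
  simpa [tangentProjL_of_tangent hX] using DFunLike.congr_fun h X

lemma hdiv_eq (hΩ : Ω ⊆ hyp n) (hS : IsOpen (cone Ω)) (hq : q ∈ Ω) {V W : L n → L n}
    {W' : L n →L[ℝ] L n} (hVW : Set.EqOn V W Ω) (hW : HasFDerivAt W W' q) :
    hdiv V q = tr W' + lor (W' q) q := by
  have hdiv_tr : hdiv V q = tr ((tangentProjL q).comp (W'.comp (tangentProjL q))) := by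
    rw [tr_apply, ← (hasFDerivAt_radialExt hΩ hS hq hVW hW).fderiv]
    rfl
  have hleft (M : L n →L[ℝ] L n) :
      (tangentProjL q).comp M = M + ((lorL.flip q).comp M).smulRight q := rfl
  have hright : W'.comp (tangentProjL q) = W' + (lorL.flip q).smulRight (W' q) := by
    ext1 X
    simp [tangentProjL]
  rw [hdiv_tr, hleft, map_add, tr_smulRight, ContinuousLinearMap.comp_apply,
    ContinuousLinearMap.comp_apply, tangentProjL_self (hΩ hq), map_zero, map_zero, add_zero,
    hright, map_add, tr_smulRight]
  rfl

end RadialProjection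

section Gap

/-- The extension of `1 - |∇u|²` to the cone that is constant along rays. -/
def gap (u : L n → ℝ) (x : L n) : ℝ := 1 + lor x x * lor (hgrad u x) (hgrad u x)

variable {u : L n → ℝ} {q X : L n}

lemma gap_smul (u : L n → ℝ) {c : ℝ} (hc : 0 < c) (x : L n) : gap u (c • x) = gap u x := by
  rw [gap, gap, posHomogeneous_hgrad u hc]
  simp only [lor_smul_left, lor_smul_right, zpow_neg_one]
  field_simp

lemma gap_of_mem_hyp (u : L n → ℝ) (hq : q ∈ hyp n) :
    gap u q = 1 - lor (hgrad u q) (hgrad u q) := by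
  rw [gap, hq.1]
  ring

lemma hasFDerivAt_gap {A : L n →L[ℝ] L n} (hA : HasFDerivAt (hgrad u) A q) :
    HasFDerivAt (gap u)
      ((2 : ℝ) • (lor (hgrad u q) (hgrad u q) • lorL q +
        lor q q • (lorL (hgrad u q)).comp A)) q := by
  refine (((hasFDerivAt_lor (hasFDerivAt_id q) (hasFDerivAt_id q)).mul
    (hasFDerivAt_lor hA hA)).const_add 1).congr_fderiv (ContinuousLinearMap.ext fun X => ?_)
  simp only [id_eq, smul_add, ContinuousLinearMap.comp_id, add_apply, smul_apply,
    ContinuousLinearMap.comp_apply, lorL_apply, smul_eq_mul, ContinuousLinearMap.flip_apply,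
    lor_comm (A X), lor_comm X]
  ring

lemma lmod_sq_of_tangent (hq : q ∈ hyp n) (hX : lor X q = 0) : lmod X ^ 2 = lor X X := by
  rw [lmod, Real.sq_sqrt (abs_nonneg _), abs_of_nonneg (lor_self_nonneg_of_tangent hq hX)]

lemma nu_of_tangent (hq : q ∈ hyp n) (hX : lor X q = 0) : nu X = (√(1 - lor X X))⁻¹ := by
  rw [nu, lmod_sq_of_tangent hq hX, one_div]

end Gap

section Equation

/-- `u` is a strictly spacelike solution of `-div (ν ∇u) + k ν = f` in `Ω`, where
`ν = (1 - |∇u|²)^{-1/2}`. -/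
structure IsSpacelikeSolution (Ω : Set (L n)) (k : ℝ) (f u : L n → ℝ) : Prop where
  eqn : ∀ q ∈ Ω, -hdiv (fun p => nu (hgrad u p) • hgrad u p) q + k * nu (hgrad u q) = f q
  spacelike : ∀ q ∈ Ω, lmod (hgrad u q) < 1

variable {Ω : Set (L n)} {k : ℝ} {f u : L n → ℝ} {q : L n}

lemma gap_pos (hq : q ∈ hyp n) (hu : DifferentiableAt ℝ (radialExt u) q)
    (h : lmod (hgrad u q) < 1) : 0 < gap u q := by
  rw [gap_of_mem_hyp u hq, sub_pos, ← lmod_sq_of_tangent hq (lor_hgrad_self hu)]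
  exact pow_lt_one₀ (Real.sqrt_nonneg _) h two_ne_zero

lemma nu_hgrad (hq : q ∈ hyp n) (hu : DifferentiableAt ℝ (radialExt u) q) :
    nu (hgrad u q) = (√(gap u q))⁻¹ := by
  rw [gap_of_mem_hyp u hq, nu_of_tangent hq (lor_hgrad_self hu)]

lemma hdiv_nu_smul_hgrad (hΩ : Ω ⊆ hyp n) (hS : IsOpen (cone Ω))
    (hu : ContDiffOn ℝ 3 (radialExt u) (cone Ω)) (hq : q ∈ Ω) (hgap : 0 < gap u q) :
    hdiv (fun p => nu (hgrad u p) • hgrad u p) q =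
      (√(gap u q))⁻¹ * (tr (fderiv ℝ (hgrad u) q) +
        (gap u q)⁻¹ * lor (fderiv ℝ (hgrad u) q (hgrad u q)) (hgrad u q)) := by
  have hu₃ {x : L n} (hx : x ∈ Ω) : ContDiffAt ℝ 3 (radialExt u) x :=
    hu.contDiffAt (hS.mem_nhds (subset_cone Ω hx))
  have J := isGradientJet_hgrad (hu₃ hq)
  have hA := ((contDiffAt_hgrad (m := 2) (hu₃ hq)).differentiableAt (by simp)).hasFDerivAt
  have hsqrt : √(gap u q) ≠ 0 := (Real.sqrt_pos.2 hgap).ne'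
  have hW := ((hasDerivAt_inv hsqrt).comp_hasFDerivAt q
    ((hasFDerivAt_gap hA).sqrt hgap.ne')).smul hA
  rw [hdiv_eq hΩ hS hq (fun x hx => congrArg (· • hgrad u x)
    (nu_hgrad (hΩ hx) ((hu₃ hx).differentiableAt (by simp)))) hW, map_add, map_smul, tr_smulRight]
  simp only [Function.comp_apply, smul_eq_mul, one_div, mul_inv_rev, (hΩ hq).1, smul_add, neg_smul,
    add_apply, neg_apply, smul_apply, lorL_apply, lor_comm q, J.lor_base, mul_zero, neg_zero,
    ContinuousLinearMap.comp_apply, lor_comm (hgrad u q) (fderiv ℝ (hgrad u) q _), neg_mul, one_mul,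
    mul_neg, neg_neg, zero_add, J.apply_base, smul_neg, ContinuousLinearMap.smulRight_apply,
    mul_one, lor_add_left, lor_neg_left, lor_smul_left, add_zero]
  field_simp
  rw [Real.sq_sqrt hgap.le]
  ring

lemma IsSpacelikeSolution.trace_eq (hsol : IsSpacelikeSolution Ω k f u) (hΩ : Ω ⊆ hyp n)
    (hS : IsOpen (cone Ω)) (hu : ContDiffOn ℝ 3 (radialExt u) (cone Ω)) (hq : q ∈ Ω) :
    tr (fderiv ℝ (hgrad u) q) +
        (gap u q)⁻¹ * lor (fderiv ℝ (hgrad u) q (hgrad u q)) (hgrad u q) =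
      k - f q * √(gap u q) := by
  have hu₁ := (hu.contDiffAt (hS.mem_nhds (subset_cone Ω hq))).differentiableAt (by simp)
  have hgap := gap_pos (hΩ hq) hu₁ (hsol.spacelike q hq)
  have h := hsol.eqn q hq
  rw [hdiv_nu_smul_hgrad hΩ hS hu hq hgap, nu_hgrad (hΩ hq) hu₁] at h
  have := Real.sqrt_pos.2 hgap
  rw [← h]
  field_simp
  ring

lemma IsSpacelikeSolution.fderiv_trace_eq (hsol : IsSpacelikeSolution Ω k f u) (hΩ : Ω ⊆ hyp n)
    (hS : IsOpen (cone Ω)) (hu : ContDiffOn ℝ 3 (radialExt u) (cone Ω)) (hq : q ∈ Ω)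
    {f' : L n →L[ℝ] ℝ} (hf : HasFDerivAt f f' q) {p : L n} (hp : hgrad u q = p)
    {A : L n →L[ℝ] L n} (hA : fderiv ℝ (hgrad u) q = A) {T : L n →L[ℝ] L n →L[ℝ] L n}
    (hT : fderiv ℝ (fderiv ℝ (hgrad u)) q = T) :
    tr (T p) + (gap u q)⁻¹ * (lor (T p p) p + 2 * lor (A p) (A p)) +
        2 * (gap u q)⁻¹ ^ 2 * lor (A p) p ^ 2 =
      f q * lor (A p) p / √(gap u q) - f' p * √(gap u q) := by
  have hu₃ := hu.contDiffAt (hS.mem_nhds (subset_cone Ω hq))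
  have hgap := gap_pos (hΩ hq) (hu₃.differentiableAt (by simp)) (hsol.spacelike q hq)
  have J := isGradientJet_hgrad hu₃
  have hP₂ := contDiffAt_hgrad (m := 2) hu₃
  have hP := (hP₂.differentiableAt (by simp)).hasFDerivAt
  have hA' := ((hP₂.fderiv_right (m := 1) le_rfl).differentiableAt one_ne_zero).hasFDerivAt
  have hlhs := (tr.hasFDerivAt.comp q hA').add
    (((hasDerivAt_inv hgap.ne').comp_hasFDerivAt q (hasFDerivAt_gap hP)).mul
      (hasFDerivAt_lor (hA'.clm_apply hP) hP))
  have hrhs := (hf.mul ((hasFDerivAt_gap hP).sqrt hgap.ne')).const_sub k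
  have h := hasFDerivAt_apply_eq_of_eqOn hΩ hS hq (fun x hx => hsol.trace_eq hΩ hS hu hx)
    hlhs hrhs J.lor_base
  subst hp hA hT
  simp only [Function.comp_apply, ContinuousLinearMap.comp_add, smul_add, (hΩ hq).1, neg_smul,
    smul_neg, add_apply, ContinuousLinearMap.comp_apply, smul_apply, lorL_apply, smul_eq_mul,
    ContinuousLinearMap.flip_apply, neg_apply, lor_comm q, J.lor_base, mul_zero, neg_zero, neg_mul,
    one_mul, mul_neg, neg_neg, zero_add, one_div, mul_inv_rev, neg_add_rev, add_zero] at h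
  have hAA := J.symm (fderiv ℝ (hgrad u) q (hgrad u q)) (hgrad u q)
  rw [lor_comm (hgrad u q)] at h
  linear_combination h - (gap u q)⁻¹ * hAA

end Equation

section MaximumPrinciple

lemma second_order_of_isLocalMax {φ φ' : ℝ → ℝ} {x c : ℝ} (hmax : IsLocalMax φ x)
    (hφ : ∀ᶠ s in 𝓝 x, HasDerivAt φ (φ' s) s) (hφ' : HasDerivAt φ' c x) : φ' x = 0 ∧ c ≤ 0 := by
  have hcrit : φ' x = 0 := hmax.hasDerivAt_eq_zero hφ.self_of_nhds
  refine ⟨hcrit, ?_⟩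
  by_contra! hc
  have hderiv : deriv φ =ᶠ[𝓝 x] φ' := hφ.mono fun s hs => hs.deriv
  have hderiv₂ : deriv (deriv φ) x = c := by rw [hderiv.deriv_eq, hφ'.deriv]
  have hmin : IsLocalMin φ x := isLocalMin_of_deriv_deriv_pos (by rwa [hderiv₂])
    (by rw [hderiv.self_of_nhds, hcrit]) hφ.self_of_nhds.continuousAt
  have hconst : φ =ᶠ[𝓝 x] fun _ => φ x :=
    (hmax.and hmin).mono fun s hs => le_antisymm hs.1 hs.2
  rw [hconst.deriv.deriv_eq] at hderiv₂
  simp [hc.ne] at hderiv₂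

lemma second_order_of_isLocalMax_log_add_sq {g g' v v' : ℝ → ℝ} {x a g'' v'' : ℝ} (hgx : 0 < g x)
    (hg : ∀ᶠ s in 𝓝 x, HasDerivAt g (g' s) s) (hg' : HasDerivAt g' g'' x)
    (hv : ∀ᶠ s in 𝓝 x, HasDerivAt v (v' s) s) (hv' : HasDerivAt v' v'' x)
    (hmax : IsLocalMax (fun s => -(1 / 2) * Real.log (g s) + a / 2 * v s ^ 2) x) :
    -(1 / 2) * (g' x * (g x)⁻¹) + a * v x * v' x = 0 ∧
      -(1 / 2) * (g'' * (g x)⁻¹ - (g' x * (g x)⁻¹) ^ 2) + a * (v' x ^ 2 + v x * v'') ≤ 0 := by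
  have hgpos : ∀ᶠ s in 𝓝 x, 0 < g s := hg.self_of_nhds.continuousAt.eventually (lt_mem_nhds hgx)
  have hfirst : ∀ᶠ s in 𝓝 x, HasDerivAt (fun s => -(1 / 2) * Real.log (g s) + a / 2 * v s ^ 2)
      (-(1 / 2) * (g' s / g s) + a * (v s * v' s)) s := by
    filter_upwards [hg, hv, hgpos] with s hgs hvs hpos
    refine (((hgs.log hpos.ne').const_mul (-(1 / 2))).add
      ((hvs.pow 2).const_mul (a / 2))).congr_deriv ?_
    ring
  have hsecond := ((hg'.div hg.self_of_nhds hgx.ne').const_mul (-(1 / 2) : ℝ)).add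
    ((hv.self_of_nhds.mul hv').const_mul a)
  obtain ⟨h₁, h₂⟩ := second_order_of_isLocalMax hmax hfirst hsecond
  constructor
  · rw [← h₁]
    ring
  · refine le_of_eq_of_le ?_ h₂
    field_simp

/-- The auxiliary function `log ν + (n / 2) u²`, extended to the cone so as to be constant along
rays. -/
def bernsteinFun (u : L n → ℝ) (x : L n) : ℝ :=
  -(1 / 2) * Real.log (gap u x) + n / 2 * radialExt u x ^ 2

lemma bernsteinFun_smul (u : L n → ℝ) {c : ℝ} (hc : 0 < c) (x : L n) :
    bernsteinFun u (c • x) = bernsteinFun u x := by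
  rw [bernsteinFun, bernsteinFun, gap_smul u hc, posHomogeneous_radialExt u hc, zpow_zero, one_smul]

variable {u : L n → ℝ} {q : L n}

lemma hasDerivAt_line (x X : L n) (s : ℝ) : HasDerivAt (fun s : ℝ => x + s • X) X s := by
  simpa only [one_smul] using ((hasDerivAt_id' s).smul_const X).const_add x

lemma tendsto_line (x X : L n) : Tendsto (fun s : ℝ => x + s • X) (𝓝 0) (𝓝 x) := by
  simpa only [zero_smul, add_zero] using (hasDerivAt_line x X 0).continuousAt.tendsto

lemma hasDerivAt_comp_line {E : Type*} [NormedAddCommGroup E] [NormedSpace ℝ E] {F : L n → E}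
    {F' : L n →L[ℝ] E} {x X : L n} {s : ℝ} (hF : HasFDerivAt F F' (x + s • X)) :
    HasDerivAt (fun s : ℝ => F (x + s • X)) (F' X) s :=
  hF.comp_hasDerivAt_of_eq s (hasDerivAt_line x X s) rfl

lemma hasDerivAt_radialExt_line {x X : L n} {s : ℝ}
    (hu : DifferentiableAt ℝ (radialExt u) (x + s • X)) :
    HasDerivAt (fun s : ℝ => radialExt u (x + s • X)) (lor (hgrad u (x + s • X)) X) s := by
  rw [lor_hgrad]
  exact hasDerivAt_comp_line hu.hasFDerivAt

lemma hasDerivAt_gap_line {x X : L n} {s : ℝ}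
    (hu : ContDiffAt ℝ 3 (radialExt u) (x + s • X)) :
    HasDerivAt (fun s : ℝ => gap u (x + s • X))
      (2 * (lor (hgrad u (x + s • X)) (hgrad u (x + s • X)) * lor (x + s • X) X +
        lor (x + s • X) (x + s • X) *
          lor (hgrad u (x + s • X)) (fderiv ℝ (hgrad u) (x + s • X) X))) s := by
  have hP := ((contDiffAt_hgrad (m := 2) hu).differentiableAt (by simp)).hasFDerivAt
  refine (hasDerivAt_comp_line (hasFDerivAt_gap hP)).congr_deriv ?_
  simp only [add_apply, smul_apply, lorL_apply, smul_eq_mul, ContinuousLinearMap.comp_apply]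

lemma second_order_of_isLocalMax_bernsteinFun (hq : q ∈ hyp n) (hu : ContDiffAt ℝ 3 (radialExt u) q)
    (hgap : 0 < gap u q) (hmax : IsLocalMax (bernsteinFun u) q) {N : ℝ} (hN : N ^ 2 = (gap u q)⁻¹)
    {X : L n} (hX : lor X q = 0) :
    N ^ 2 * lor (fderiv ℝ (hgrad u) q X) (hgrad u q) +
        n * radialExt u q * lor (hgrad u q) X = 0 ∧
      hessForm (hgrad u q) (fderiv ℝ (hgrad u) q) (fderiv ℝ (fderiv ℝ (hgrad u)) q) N
        (n * radialExt u q) n X ≤ 0 := by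
  have hline : q + (0 : ℝ) • X = q := by rw [zero_smul, add_zero]
  have hgrad₂ := contDiffAt_hgrad (m := 2) hu
  have hP := (hgrad₂.differentiableAt (by simp)).hasFDerivAt
  have hA := ((hgrad₂.fderiv_right (m := 1) le_rfl).differentiableAt one_ne_zero).hasFDerivAt
  have hsmooth : ∀ᶠ s : ℝ in 𝓝 0, ContDiffAt ℝ 3 (radialExt u) (q + s • X) :=
    (tendsto_line q X).eventually (hu.eventually (by simp))
  rw [← hline] at hP hA
  have hx₀ := hasDerivAt_line q X 0
  have hX₀ := hasDerivAt_const (0 : ℝ) X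
  have hP₀ := hasDerivAt_comp_line hP
  have hg' := ((((hasDerivAt_lor hP₀ hP₀).mul (hasDerivAt_lor hx₀ hX₀)).add
    ((hasDerivAt_lor hx₀ hx₀).mul
      (hasDerivAt_lor hP₀ ((hasDerivAt_comp_line hA).clm_apply hX₀)))).const_mul 2)
  have hmax₀ : IsLocalMax (fun s : ℝ => bernsteinFun u (q + s • X)) 0 := by
    simpa only [IsLocalMax, IsMaxFilter, hline] using (tendsto_line q X).eventually hmax
  obtain ⟨h₁, h₂⟩ := second_order_of_isLocalMax_log_add_sq (by rwa [hline])
    (hsmooth.mono fun s hs => hasDerivAt_gap_line hs) hg'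
    (hsmooth.mono fun s hs => hasDerivAt_radialExt_line (hs.differentiableAt (by simp)))
    (hasDerivAt_lor hP₀ hX₀) hmax₀
  rw [hessForm, show N ^ 4 = (N ^ 2) ^ 2 by ring, hN]
  simp only [hline, hq.1, hX, lor_comm q X, lor_comm _ (fderiv ℝ (hgrad u) q X),
    lor_comm _ (fderiv ℝ (fderiv ℝ (hgrad u)) q X X), lor_zero_right, map_zero, add_zero] at h₁ h₂
  constructor
  · linear_combination h₁
  · linear_combination h₂

variable {Ω : Set (L n)} {k : ℝ} {f : L n → ℝ} {f' : L n →L[ℝ] ℝ}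

lemma IsSpacelikeSolution.sq_nu_le_of_isLocalMax (hsol : IsSpacelikeSolution Ω k f u)
    (hΩ : Ω ⊆ hyp n) (hS : IsOpen (cone Ω)) (hu : ContDiffOn ℝ 3 (radialExt u) (cone Ω))
    (hq : q ∈ Ω) (hf : HasFDerivAt f f' q) (hmax : IsLocalMax (bernsteinFun u) q) :
    nu (hgrad u q) ^ 2 ≤
      1 + nu (hgrad u q) *
          (f' (hgrad u q) + n * radialExt u q * lor (hgrad u q) (hgrad u q) * f q) -
        n * radialExt u q * (k - f q / nu (hgrad u q)) := by
  have hu₃ := hu.contDiffAt (hS.mem_nhds (subset_cone Ω hq))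
  have hu₁ := hu₃.differentiableAt (by simp)
  have hgap := gap_pos (hΩ hq) hu₁ (hsol.spacelike q hq)
  have hnu := nu_hgrad (hΩ hq) hu₁
  have hN : nu (hgrad u q) ^ 2 = (gap u q)⁻¹ := by rw [hnu, inv_pow, Real.sq_sqrt hgap.le]
  have hNpos : 0 < nu (hgrad u q) := by rw [hnu]; exact inv_pos.2 (Real.sqrt_pos.2 hgap)
  have hsqrt : √(gap u q) = (nu (hgrad u q))⁻¹ := by rw [hnu, inv_inv]
  have hNgap : nu (hgrad u q) ^ 2 * (1 - lor (hgrad u q) (hgrad u q)) = 1 := by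
    rw [hN, ← gap_of_mem_hyp u (hΩ hq), inv_mul_cancel₀ hgap.ne']
  have J := isGradientJet_hgrad hu₃
  have hcrit := fun X => second_order_of_isLocalMax_bernsteinFun (X := X) (hΩ hq) hu₃ hgap hmax hN
  have hbern := J.bernstein (hΩ hq) hNgap (fun X hX => (hcrit X hX).1) (fun X hX => (hcrit X hX).2)
  have htrace := hsol.trace_eq hΩ hS hu hq
  have htrace' := hsol.fderiv_trace_eq hΩ hS hu hq hf rfl rfl rfl
  rw [← hN, hsqrt] at htrace htrace'
  have hfirst := (hcrit _ J.lor_base).1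
  have hcancel : nu (hgrad u q) ^ 2 * (nu (hgrad u q))⁻¹ = nu (hgrad u q) := by field_simp
  rw [div_inv_eq_mul] at htrace'
  linear_combination hbern - nu (hgrad u q) ^ 2 * htrace' - n * radialExt u q * htrace -
    f q * nu (hgrad u q) * hfirst + f' (hgrad u q) * hcancel

lemma lor_hgrad_self_lt_one (hq : q ∈ hyp n) (hu : DifferentiableAt ℝ (radialExt u) q)
    (h : lmod (hgrad u q) < 1) : lor (hgrad u q) (hgrad u q) < 1 :=
  sub_pos.1 (gap_of_mem_hyp u hq ▸ gap_pos hq hu h)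

lemma one_le_nu_hgrad (hq : q ∈ hyp n) (hu : DifferentiableAt ℝ (radialExt u) q)
    (h : lmod (hgrad u q) < 1) : 1 ≤ nu (hgrad u q) := by
  rw [nu_hgrad hq hu]
  refine (one_le_inv₀ (Real.sqrt_pos.2 (gap_pos hq hu h))).2 (Real.sqrt_le_one.2 ?_)
  rw [gap_of_mem_hyp u hq]
  exact sub_le_self 1 (lor_self_nonneg_of_tangent hq (lor_hgrad_self hu))

lemma IsSpacelikeSolution.nu_le_of_isLocalMax (hsol : IsSpacelikeSolution Ω k f u)
    (hΩ : Ω ⊆ hyp n) (hS : IsOpen (cone Ω)) (hu : ContDiffOn ℝ 3 (radialExt u) (cone Ω))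
    (hq : q ∈ Ω) (hf : HasFDerivAt f f' q) (hmax : IsLocalMax (bernsteinFun u) q) {M κ B B' : ℝ}
    (hM : |u q| ≤ M) (hk : |k| ≤ κ) (hB : |f q| ≤ B) (hB' : |f' (hgrad u q)| ≤ B') :
    nu (hgrad u q) ≤ 1 + (B' + n * M * B) + n * M * (κ + B) := by
  have hu₁ := (hu.contDiffAt (hS.mem_nhds (subset_cone Ω hq))).differentiableAt (by simp)
  have hsq := hsol.sq_nu_le_of_isLocalMax hΩ hS hu hq hf hmax
  rw [radialExt_of_mem_hyp u (hΩ hq)] at hsq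
  have hN := one_le_nu_hgrad (hΩ hq) hu₁ (hsol.spacelike q hq)
  have hw := lor_hgrad_self_lt_one (hΩ hq) hu₁ (hsol.spacelike q hq)
  have hw₀ := lor_self_nonneg_of_tangent (hΩ hq) (lor_hgrad_self hu₁)
  have hM₀ : 0 ≤ M := (abs_nonneg _).trans hM
  have hB₀ : 0 ≤ B := (abs_nonneg _).trans hB
  have hκ₀ : 0 ≤ κ := (abs_nonneg _).trans hk
  have hlinear : f' (hgrad u q) + n * u q * lor (hgrad u q) (hgrad u q) * f q ≤
      B' + n * M * B := by
    refine add_le_add (le_of_abs_le hB') (le_of_abs_le ?_)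
    rw [abs_mul, abs_mul, abs_mul, Nat.abs_cast, abs_of_nonneg hw₀]
    calc n * |u q| * lor (hgrad u q) (hgrad u q) * |f q| ≤ n * M * 1 * B := by gcongr
      _ = n * M * B := by ring
  have hconst : -(n * u q * (k - f q / nu (hgrad u q))) ≤ n * M * (κ + B) := by
    refine (neg_le_abs _).trans ?_
    rw [abs_mul, abs_mul, Nat.abs_cast]
    have hfN : |f q / nu (hgrad u q)| ≤ B := by
      rw [abs_div, abs_of_pos (one_pos.trans_le hN)]
      exact (div_le_self (abs_nonneg _) hN).trans hB
    gcongr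
    exact (abs_sub _ _).trans (add_le_add hk hfN)
  have hconst₀ : 0 ≤ n * M * (κ + B) := by positivity
  nlinarith [mul_le_mul_of_nonneg_left hlinear (one_pos.trans_le hN).le]

end MaximumPrinciple

section Hyperboloid

variable {p q : L n} {Ω : Set (L n)}

lemma norm_sq_eq_lor (x : L n) : ‖x‖ ^ 2 = lor x x + 2 * x (Fin.last n) ^ 2 := by
  rw [EuclideanSpace.real_norm_sq_eq, Fin.sum_univ_castSucc, lor]
  simp only [← sq]
  ring

lemma sq_lor_add_last_mul_last_le (x y : L n) :
    (lor x y + x (Fin.last n) * y (Fin.last n)) ^ 2 ≤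
      (lor x x + x (Fin.last n) ^ 2) * (lor y y + y (Fin.last n) ^ 2) := by
  simpa only [lor, ← sq, sub_add_cancel] using Finset.sum_mul_sq_le_sq_mul_sq Finset.univ
    (fun i : Fin n => x i.castSucc) (fun i : Fin n => y i.castSucc)

lemma one_le_last_of_mem_hyp (hq : q ∈ hyp n) : 1 ≤ q (Fin.last n) := by
  have hsq := sum_sq_castSucc hq
  have hsum : 0 ≤ ∑ i : Fin n, q i.castSucc ^ 2 := Finset.sum_nonneg fun _ _ => sq_nonneg _
  nlinarith [hq.2]

lemma norm_le_of_tangent (hq : q ∈ hyp n) (hpq : lor p q = 0) (hp : lor p p ≤ 1) :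
    ‖p‖ ≤ 1 + 2 * ‖q‖ := by
  have hcs := sq_lor_add_last_mul_last_le p q
  have hlast : 1 ≤ q (Fin.last n) ^ 2 := one_le_pow₀ (one_le_last_of_mem_hyp hq)
  have hnq := norm_sq_eq_lor q
  rw [hq.1] at hcs hnq
  rw [hpq] at hcs
  have hplast : p (Fin.last n) ^ 2 ≤ q (Fin.last n) ^ 2 - 1 := by
    linear_combination hcs + mul_nonneg (sub_nonneg.2 hp) (sub_nonneg.2 hlast)
  refine abs_le_of_sq_le_sq' ?_ (by positivity) |>.2
  nlinarith [norm_nonneg q, norm_sq_eq_lor p]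

lemma norm_le_mul_neg_lor (hp : p ∈ hyp n) (hq : q ∈ hyp n) :
    ‖q‖ ≤ 4 * p (Fin.last n) * -lor p q := by
  have hcs := sq_lor_add_last_mul_last_le p q
  have hnq := norm_sq_eq_lor q
  rw [hp.1, hq.1] at hcs
  rw [hq.1] at hnq
  have hplast : 1 ≤ p (Fin.last n) ^ 2 := one_le_pow₀ (one_le_last_of_mem_hyp hp)
  have hqlast : q (Fin.last n) ≤ 2 * p (Fin.last n) * -lor p q := by
    refine le_of_mul_le_mul_right ?_ hq.2
    linear_combination hcs + hplast + sq_nonneg (lor p q)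
  have hnorm : ‖q‖ ≤ 2 * q (Fin.last n) :=
    abs_le_of_sq_le_sq' (by nlinarith) (by linarith [hq.2]) |>.2
  linarith

lemma isClosed_hyp : IsClosed (hyp n) := by
  have hyp_eq : hyp n = {x | lor x x = -1} ∩ {x | 0 ≤ x (Fin.last n)} := by
    refine Set.Subset.antisymm (fun x hx => ⟨hx.1, hx.2.le⟩) fun x hx => ⟨hx.1, hx.2.lt_of_ne ?_⟩
    intro hlast
    have hself : lor x x = -1 := hx.1
    have hsum : 0 ≤ ∑ i : Fin n, x i.castSucc * x i.castSucc :=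
      Finset.sum_nonneg fun _ _ => mul_self_nonneg _
    rw [lor, ← hlast] at hself
    linarith
  rw [hyp_eq]
  exact (isClosed_eq continuous_lor_self continuous_const).inter
    (isClosed_le continuous_const (EuclideanSpace.proj (𝕜 := ℝ) (Fin.last n)).continuous)

lemma neg_lor_le_cosh_of_hdist_le {R : ℝ} (h : hdist p q ≤ R) : -lor p q ≤ Real.cosh R := by
  rcases le_or_gt 1 (-lor p q) with hone | hone
  · rw [← Real.cosh_arcosh hone, Real.cosh_le_cosh, abs_of_nonneg (Real.arcosh_nonneg hone)]
    exact h.trans (le_abs_self R)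
  · exact hone.le.trans (Real.one_le_cosh R)

lemma subset_hyp_of_eq_inter (hΩ : ∃ U, IsOpen U ∧ Ω = hyp n ∩ U) : Ω ⊆ hyp n := by
  obtain ⟨U, -, rfl⟩ := hΩ
  exact Set.inter_subset_left

lemma isBounded_of_hdist_le (hΩ : Ω ⊆ hyp n) {R : ℝ} (hR : ∀ p ∈ Ω, ∀ q ∈ Ω, hdist p q ≤ R) :
    Bornology.IsBounded Ω := by
  rcases Ω.eq_empty_or_nonempty with rfl | ⟨p, hp⟩
  · exact Bornology.isBounded_empty
  refine isBounded_iff_forall_norm_le.2 ⟨4 * p (Fin.last n) * Real.cosh R, fun q hq => ?_⟩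
  have hlast := (hΩ hp).2
  refine (norm_le_mul_neg_lor (hΩ hp) (hΩ hq)).trans ?_
  gcongr
  exact neg_lor_le_cosh_of_hdist_le (hR p hp q hq)

end Hyperboloid

section UpToBoundary

variable {Ω U K : Set (L n)} {f u : L n → ℝ} {q : L n}

lemma ContDiffUpTo.of_le {j k : ℕ} (h : ContDiffUpTo k f U K) (hjk : j ≤ k) :
    ContDiffUpTo j f U K :=
  ⟨h.1.of_le (mod_cast hjk), h.2.1, fun i hi => h.2.2 i (hi.trans hjk)⟩

lemma ContDiffUpTo.exists_fderiv_extension (h : ContDiffUpTo 1 f U K) :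
    ∃ g : L n → (L n →L[ℝ] ℝ), ContinuousOn g K ∧ Set.EqOn (fderiv ℝ f) g U := by
  obtain ⟨g, hg, hgU⟩ := h.2.2 1 le_rfl
  refine ⟨fun x => continuousMultilinearCurryFin1 ℝ (L n) ℝ (g x),
    (continuousMultilinearCurryFin1 ℝ (L n) ℝ).continuous.comp_continuousOn hg, fun x hx => ?_⟩
  ext X
  simp [← hgU hx, iteratedFDeriv_one_apply]

lemma continuousOn_hgradBar (hu : MemCkClosure 1 u Ω) :
    ContinuousOn (hgradBar u Ω) (closure Ω) := by
  obtain ⟨g, hg, hgU⟩ := ContDiffUpTo.exists_fderiv_extension hu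
  refine continuousOn_extendFrom subset_rfl fun x hx => ⟨sharpL (g x), ?_⟩
  have hlim : ContinuousWithinAt (fun y => sharpL (g y)) Ω x :=
    sharpL.continuous.continuousAt.comp_continuousWithinAt
      ((hg x (subset_cone _ hx)).mono (subset_closure.trans (subset_cone _)))
  refine hlim.tendsto.congr' ?_
  filter_upwards [self_mem_nhdsWithin] with y hy
  rw [sharpL_apply, ← hgU (subset_cone Ω hy), hgrad]

lemma hgradBar_of_mem (hS : IsOpen (cone Ω)) (hu : ContDiffOn ℝ 2 (radialExt u) (cone Ω))
    (hq : q ∈ Ω) : hgradBar u Ω q = hgrad u q :=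
  extendFrom_extends (fun _ hx => ((contDiffAt_hgrad (m := 1) (hu.contDiffAt
    (hS.mem_nhds (subset_cone Ω hx)))).continuousAt).continuousWithinAt) q hq

lemma MemCkClosure.continuousOn {k : ℕ} (hu : MemCkClosure k u Ω) (hΩ : Ω ⊆ hyp n) :
    ContinuousOn u (closure Ω) :=
  (hu.2.1.mono (subset_cone _)).congr fun _ hx =>
    (radialExt_of_mem_hyp u (closure_minimal hΩ isClosed_hyp hx)).symm

lemma one_sub_lmod_sq_pos {v : L n} (hv : lmod v < 1) : 0 < 1 - lmod v ^ 2 :=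
  sub_pos.2 (pow_lt_one₀ (Real.sqrt_nonneg _) hv two_ne_zero)

lemma nu_pos {v : L n} (hv : lmod v < 1) : 0 < nu v :=
  one_div_pos.2 (Real.sqrt_pos.2 (one_sub_lmod_sq_pos hv))

lemma continuousOn_nu : ContinuousOn nu {v : L n | lmod v < 1} :=
  continuousOn_const.div
    (continuous_const.sub (continuous_lmod.pow 2)).sqrt.continuousOn fun _ hv =>
      (Real.sqrt_pos.2 (one_sub_lmod_sq_pos hv)).ne'

end UpToBoundary

section GlobalMaximum

variable {Ω : Set (L n)} {u : L n → ℝ} {q : L n}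

lemma bernsteinFun_of_mem_hyp (hq : q ∈ hyp n) (hu : DifferentiableAt ℝ (radialExt u) q)
    (h : lmod (hgrad u q) < 1) :
    bernsteinFun u q = Real.log (nu (hgrad u q)) + n / 2 * u q ^ 2 := by
  rw [bernsteinFun, radialExt_of_mem_hyp u hq, nu_hgrad hq hu, Real.log_inv,
    Real.log_sqrt (gap_pos hq hu h).le]
  ring

lemma isLocalMax_bernsteinFun (hS : IsOpen (cone Ω)) (hq : q ∈ Ω)
    (hmax : IsMaxOn (bernsteinFun u) Ω q) : IsLocalMax (bernsteinFun u) q := by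
  filter_upwards [hS.mem_nhds (subset_cone Ω hq)] with x hx
  obtain ⟨y, hy, ρ, hρ, rfl⟩ := hx
  rw [bernsteinFun_smul u hρ]
  exact hmax hy

lemma le_mul_exp_of_log_add_sq_le {ν ν₁ K M a v v₁ : ℝ} (hν : 0 < ν) (hν₁ : 0 < ν₁) (ha : 0 ≤ a)
    (h : Real.log ν + a * v ^ 2 ≤ Real.log ν₁ + a * v₁ ^ 2) (hK : ν₁ ≤ K) (hM : |v₁| ≤ M) :
    ν ≤ K * Real.exp (a * M ^ 2) := by
  have hsq : v₁ ^ 2 ≤ M ^ 2 := sq_le_sq.2 (hM.trans (le_abs_self M))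
  calc ν = Real.exp (Real.log ν) := (Real.exp_log hν).symm
    _ ≤ Real.exp (Real.log ν₁ + a * M ^ 2) := by
        gcongr
        exact (le_add_of_nonneg_right (by positivity)).trans (h.trans (by gcongr))
    _ = ν₁ * Real.exp (a * M ^ 2) := by rw [Real.exp_add, Real.exp_log hν₁]
    _ ≤ K * Real.exp (a * M ^ 2) := by gcongr

lemma nu_hgrad_le_of_isLocalMax_bound (hΩ : Ω ⊆ hyp n) (hS : IsOpen (cone Ω))
    (hb : Bornology.IsBounded Ω) (hu : ContDiffOn ℝ 2 (radialExt u) (cone Ω))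
    (hu' : MemCkClosure 1 u Ω) (hsl : ∀ q ∈ Ω, lmod (hgrad u q) < 1) {M K ν₀ : ℝ}
    (hM : ∀ q ∈ Ω, |u q| ≤ M)
    (hbd : ∀ q ∈ bdry Ω, lmod (hgradBar u Ω q) < 1 ∧ nu (hgradBar u Ω q) ≤ ν₀)
    (hint : ∀ q ∈ Ω, IsLocalMax (bernsteinFun u) q → nu (hgrad u q) ≤ K) (hq : q ∈ Ω) :
    nu (hgrad u q) ≤ max ν₀ K * Real.exp (n / 2 * M ^ 2) := by
  have hbar {x : L n} (hx : x ∈ Ω) : hgradBar u Ω x = hgrad u x := hgradBar_of_mem hS hu hx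
  have hlt {x : L n} (hx : x ∈ closure Ω) : lmod (hgradBar u Ω x) < 1 := by
    by_cases hxΩ : x ∈ Ω
    · exact hbar hxΩ ▸ hsl x hxΩ
    · exact (hbd x ⟨hx, hxΩ⟩).1
  have hu₀ := hu'.continuousOn hΩ
  set Ψ : L n → ℝ := fun x => Real.log (nu (hgradBar u Ω x)) + n / 2 * u x ^ 2
  have hΨ : ContinuousOn Ψ (closure Ω) :=
    ((continuousOn_nu.comp (continuousOn_hgradBar hu') fun x hx => hlt hx).log fun x hx =>
      (nu_pos (hlt hx)).ne').add (continuousOn_const.mul (hu₀.pow 2))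
  have hΨ_eq {x : L n} (hx : x ∈ Ω) : bernsteinFun u x = Ψ x := by
    rw [bernsteinFun_of_mem_hyp (hΩ hx) ((hu.contDiffAt
      (hS.mem_nhds (subset_cone Ω hx))).differentiableAt (by simp)) (hsl x hx), ← hbar hx]
  obtain ⟨q₀, hq₀, hmax⟩ := hb.isCompact_closure.exists_isMaxOn ⟨q, subset_closure hq⟩ hΨ
  have hK : nu (hgradBar u Ω q₀) ≤ max ν₀ K := by
    by_cases hq₀Ω : q₀ ∈ Ω
    · refine le_max_of_le_right (hbar hq₀Ω ▸ hint q₀ hq₀Ω (isLocalMax_bernsteinFun hS hq₀Ω ?_))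
      intro x hx
      simpa only [Set.mem_ofPred_eq, hΨ_eq hx, hΨ_eq hq₀Ω] using hmax (subset_closure hx)
    · exact le_max_of_le_left (hbd q₀ ⟨hq₀, hq₀Ω⟩).2
  have hM₀ : |u q₀| ≤ M := le_on_closure hM hu₀.abs continuousOn_const hq₀
  have hle : Ψ q ≤ Ψ q₀ := hmax (subset_closure hq)
  rw [← hbar hq]
  exact le_mul_exp_of_log_add_sq_le (nu_pos (hlt (subset_closure hq))) (nu_pos (hlt hq₀))
    (by positivity) hle hK hM₀

end GlobalMaximum

section CurvatureTerm

variable {Ω : Set (L n)} {H u : L n → ℝ} {q : L n}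

/-- The term `e^u H(e^u q)` of the equation, as a function on the cone: `u` is extended radially. -/
def curvTerm (H u : L n → ℝ) (x : L n) : ℝ :=
  Real.exp (radialExt u x) * H (Real.exp (radialExt u x) • x)

lemma hasFDerivAt_curvTerm (hu : DifferentiableAt ℝ (radialExt u) q)
    (hH : DifferentiableAt ℝ H (Real.exp (radialExt u q) • q)) :
    ∃ F' : L n →L[ℝ] ℝ, HasFDerivAt (curvTerm H u) F' q ∧ ∀ X, F' X =
      Real.exp (radialExt u q) * (lor (hgrad u q) X * H (Real.exp (radialExt u q) • q) +
        Real.exp (radialExt u q) * fderiv ℝ H (Real.exp (radialExt u q) • q)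
          (X + lor (hgrad u q) X • q)) := by
  have hexp := hu.hasFDerivAt.exp
  have hH' := hH.hasFDerivAt.comp (f := fun x => Real.exp (radialExt u x) • x) q
    (hexp.smul (hasFDerivAt_id q))
  refine ⟨_, hexp.mul hH', fun X => ?_⟩
  simp only [ContinuousLinearMap.comp_add, ContinuousLinearMap.comp_smulₛₗ, Real.ringHom_apply,
    ContinuousLinearMap.comp_id, smul_add, add_apply, smul_apply, smul_eq_mul,
    ContinuousLinearMap.comp_apply, ContinuousLinearMap.smulRight_apply, map_smul, lor_hgrad,
    map_add]
  ring

lemma exists_bound_on_dilates (hb : Bornology.IsBounded Ω)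
    (hH : ContDiffUpTo 1 H (cone Ω) (cone (closure Ω))) (M : ℝ) :
    ∃ B, ∀ s, |s| ≤ M → ∀ q ∈ Ω,
      |H (Real.exp s • q)| ≤ B ∧ ‖fderiv ℝ H (Real.exp s • q)‖ ≤ B := by
  obtain ⟨g, hg, hgΩ⟩ := hH.exists_fderiv_extension
  set Z : Set (L n) := (fun z : ℝ × L n => Real.exp z.1 • z.2) ''
    (Set.Icc (-M) M ×ˢ closure Ω)
  have hZ : IsCompact Z := (isCompact_Icc.prod hb.isCompact_closure).image (by fun_prop)
  have hZ_sub : Z ⊆ cone (closure Ω) := by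
    rintro _ ⟨⟨s, x⟩, ⟨_, hx⟩, rfl⟩
    exact ⟨x, hx, Real.exp s, Real.exp_pos s, rfl⟩
  obtain ⟨B₀, hB₀⟩ := hZ.exists_bound_of_continuousOn (hH.2.1.mono hZ_sub)
  obtain ⟨B₁, hB₁⟩ := hZ.exists_bound_of_continuousOn (hg.mono hZ_sub)
  refine ⟨max B₀ B₁, fun s hs q hq => ?_⟩
  have hmem : Real.exp s • q ∈ Z := ⟨(s, q), ⟨abs_le.1 hs, subset_closure hq⟩, rfl⟩
  rw [hgΩ ⟨q, hq, Real.exp s, Real.exp_pos s, rfl⟩]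
  exact ⟨le_max_of_le_left (hB₀ _ hmem), le_max_of_le_right (hB₁ _ hmem)⟩

lemma exists_bound_curvTerm (hΩ : Ω ⊆ hyp n) (hS : IsOpen (cone Ω)) (hb : Bornology.IsBounded Ω)
    (hH : ContDiffUpTo 1 H (cone Ω) (cone (closure Ω))) (M : ℝ) :
    ∃ B, ∀ u, ∀ q ∈ Ω, DifferentiableAt ℝ (radialExt u) q → lmod (hgrad u q) < 1 → |u q| ≤ M →
      |curvTerm H u q| ≤ B ∧
        ∃ F' : L n →L[ℝ] ℝ, HasFDerivAt (curvTerm H u) F' q ∧ |F' (hgrad u q)| ≤ B := by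
  obtain ⟨Q, hQ⟩ := hb.exists_norm_le
  obtain ⟨B, hB⟩ := exists_bound_on_dilates hb hH M
  refine ⟨Real.exp M * (B + Real.exp M * (B * (1 + 3 * Q))), fun u q hq hu hsl hM => ?_⟩
  have hw := lor_hgrad_self_lt_one (hΩ hq) hu hsl
  have hw₀ := lor_self_nonneg_of_tangent (hΩ hq) (lor_hgrad_self hu)
  have hp := norm_le_of_tangent (hΩ hq) (lor_hgrad_self hu) hw.le
  have hQq := hQ q hq
  have hQ₀ : 0 ≤ Q := (norm_nonneg q).trans hQq
  obtain ⟨hH₀, hH₁⟩ := hB (u q) hM q hq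
  have hB₀ : 0 ≤ B := (abs_nonneg _).trans hH₀
  have hexp : Real.exp (u q) ≤ Real.exp M := Real.exp_le_exp.2 (le_of_abs_le hM)
  have huq := radialExt_of_mem_hyp u (hΩ hq)
  have hHd : DifferentiableAt ℝ H (Real.exp (radialExt u q) • q) :=
    (hH.1.contDiffAt (hS.mem_nhds ⟨q, hq, _, Real.exp_pos _, rfl⟩)).differentiableAt (by simp)
  obtain ⟨F', hF', hF'_apply⟩ := hasFDerivAt_curvTerm hu hHd
  refine ⟨?_, F', hF', ?_⟩
  · rw [curvTerm, huq, abs_mul, Real.abs_exp]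
    gcongr
    exact hH₀.trans (le_add_of_nonneg_right (by positivity))
  · have hdir : ‖hgrad u q + lor (hgrad u q) (hgrad u q) • q‖ ≤ 1 + 3 * Q := by
      refine (norm_add_le _ _).trans ?_
      rw [norm_smul, Real.norm_of_nonneg hw₀]
      nlinarith [norm_nonneg q]
    rw [hF'_apply, huq, abs_mul, Real.abs_exp]
    gcongr
    refine (abs_add_le _ _).trans ?_
    rw [abs_mul, abs_mul, Real.abs_exp, abs_of_nonneg hw₀]
    gcongr
    · exact (mul_le_of_le_one_left (abs_nonneg _) hw.le).trans hH₀
    · exact (fderiv ℝ H _).le_of_opNorm_le_of_le hH₁ hdir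

end CurvatureTerm

lemma IsSpacelikeSolution.congr {Ω : Set (L n)} {k : ℝ} {f g u : L n → ℝ}
    (h : IsSpacelikeSolution Ω k f u) (hfg : Set.EqOn f g Ω) : IsSpacelikeSolution Ω k g u :=
  ⟨fun q hq => (h.eqn q hq).trans (hfg hq), h.spacelike⟩

end

end HBump

open HBump in
theorem proposition8p1_general {n : ℕ} {Ω : Set (L n)}
    (hΩ : ∃ U, IsOpen U ∧ Ω = hyp n ∩ U) (hb : Bornology.IsBounded Ω) {H : L n → ℝ}
    (hH : ContDiffUpTo 1 H (cone Ω) (cone (closure Ω))) (τ M ν₀ : ℝ) :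
    ∃ C : ℝ, 0 < C ∧ ∀ t, |t| ≤ τ → ∀ u : L n → ℝ, ContDiffOn ℝ 3 (radialExt u) (cone Ω) →
      MemCkClosure 1 u Ω →
      IsSpacelikeSolution Ω (n * t)
        (fun q => n * t * Real.exp (u q) * H (Real.exp (u q) • q)) u →
      (∀ q ∈ Ω, |u q| ≤ M) →
      (∀ q ∈ bdry Ω, lmod (hgradBar u Ω q) < 1 ∧ nu (hgradBar u Ω q) ≤ ν₀) →
      ∀ q ∈ Ω, nu (hgrad u q) ≤ C := by
  have hS := isOpen_cone hΩ
  have hΩ' := subset_hyp_of_eq_inter hΩ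
  obtain ⟨B, hB⟩ := exists_bound_curvTerm hΩ' hS hb hH M
  refine ⟨max 1 (max ν₀ (1 + (n * τ * B + n * M * (n * τ * B)) + n * M * (n * τ + n * τ * B)) *
    Real.exp (n / 2 * M ^ 2)), lt_max_of_lt_left one_pos, fun t ht u hu hu' hsol hM hbd q hq =>
    le_max_of_le_right (nu_hgrad_le_of_isLocalMax_bound hΩ' hS hb (hu.of_le (by norm_num)) hu'
      hsol.spacelike hM hbd (fun q hq hmax => ?_) hq)⟩
  have hu₁ := (hu.contDiffAt (hS.mem_nhds (subset_cone Ω hq))).differentiableAt (by simp)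
  obtain ⟨hB₀, F', hF', hB₁⟩ := hB u q hq hu₁ (hsol.spacelike q hq) (hM q hq)
  have hsol' : IsSpacelikeSolution Ω (n * t) (fun x => n * t * curvTerm H u x) u :=
    hsol.congr fun x hx => by simp only [curvTerm, radialExt_of_mem_hyp u (hΩ' hx), mul_assoc]
  have hnt : |n * t| ≤ n * τ := by
    rw [abs_mul, Nat.abs_cast]
    gcongr
  have hscale {y : ℝ} (hy : |y| ≤ B) : |n * t * y| ≤ n * τ * B :=
    (abs_mul _ _).trans_le (mul_le_mul hnt hy (abs_nonneg _) ((abs_nonneg _).trans hnt))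
  exact hsol'.nu_le_of_isLocalMax hΩ' hS hu hq (hF'.const_mul _) hmax (hM q hq) hnt
    (hscale hB₀) (hscale hB₁)

theorem proposition8p1 (n : ℕ) (hn : 2 ≤ n)
    (Ω : Set (HBump.L n)) (hΩ : HBump.IsBoundedDomain Ω)
    (H : HBump.L n → ℝ)
    (hH : HBump.ContDiffUpTo 1 H (HBump.cone Ω) (HBump.cone (closure Ω)))
    (r₁ r₂ : ℝ) (hr : r₁ ≠ r₂) (hr₁ : 0 < r₁) (hr₁' : r₁ ≤ 1) (hr₂ : 1 ≤ r₂)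
    (ν₀ : ℝ) (hν₀ : 0 < ν₀) :
    ∃ C : ℝ, 0 < C ∧
      ∀ t ∈ Set.Icc (0 : ℝ) 1, ∀ u : HBump.L n → ℝ,
        HBump.MemCkClosure 3 u Ω →
        HBump.IsSolution Ω H t u →
        (∀ q ∈ Ω, Real.log r₁ ≤ u q ∧ u q ≤ Real.log r₂) →
        (∀ q ∈ HBump.bdry Ω, HBump.lmod (HBump.hgradBar u Ω q) < 1 ∧
          HBump.nu (HBump.hgradBar u Ω q) ≤ ν₀) →
        ∀ q ∈ Ω, HBump.nu (HBump.hgrad u q) ≤ C := by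
  obtain ⟨R, hR⟩ := hΩ.bounded
  obtain ⟨C, hC, hle⟩ := proposition8p1_general hΩ.isOpen
    (HBump.isBounded_of_hdist_le (HBump.subset_hyp_of_eq_inter hΩ.isOpen) hR) hH 1
    (max |Real.log r₁| |Real.log r₂|) ν₀
  exact ⟨C, hC, fun t ht u hu hsol hlog => hle t (abs_le.2 ⟨by linarith [ht.1], ht.2⟩) u hu.1
    (hu.of_le (by norm_num)) ⟨hsol.eqn, hsol.spacelike⟩
    fun q hq => abs_le_max_abs_abs (hlog q hq).1 (hlog q hq).2⟩
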